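/- Write $x^g = g^{-1}xg$. A subsemigroup $P$ of a group $H$ (a possibly empty subset closed under multiplication) is called normal if $p^h\in P$ for all $p\in P$, $h\in H$. A subgroup $H$ of a group $G$ is called multi-malnormal in $G$ if for every normal subsemigroup $P$ of $H$ with $1\notin P$ we have $c_1^{g_1}\cdots c_n^{g_n}\notin H$ for all $n\ge 1$, all $c_1,\dots,c_n\in P$ and all $g_1,\dots,g_n\in G\setminus H$. (1) Let $A$ and $B$ be groups. Then $A$ is multi-malnormal in the free product $A*B$. (2) More generally, let $G=A*_C B$ be the free product of groups $A$ and $B$ amalgamated along a common subgroup $C$, and let $P$ be a normal subsemigroup of $A$ with $P\cap C=\emptyset$. Then $d_1^{f_1}\cdots d_n^{f_n}\notin A$ for all $n\ge 1$, all $d_1,\dots,d_n\in P$ and all $f_1,\dots,f_n\in G\setminus A$. -/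

import Mathlib

/-- A subsemigroup `P` of a group `A` (possibly empty) is normal if it is closed under conjugation
by all elements of `A`. -/
def IsNormalSubsemigroup {A : Type*} [Group A] (P : Subsemigroup A) : Prop :=
  ∀ p ∈ P, ∀ a : A, a⁻¹ * p * a ∈ P

/-- The product `c₁^{g₁} ⋯ cₙ^{gₙ}` (in this order) of the conjugates `c^g = g⁻¹ c g`. -/
def conjProd {G : Type*} [Group G] {n : ℕ} (c g : Fin n → G) : G :=
  (List.ofFn fun i => (g i)⁻¹ * c i * g i).prod

/-- A subgroup `C` of `G` is multi-malnormal if for every normal subsemigroup `P` of `C` with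
`1 ∉ P`, no product of `n ≥ 1` conjugates of elements of `P` by elements outside `C` lies in `C`. -/
def IsMultiMalnormal {G : Type*} [Group G] (C : Subgroup G) : Prop :=
  ∀ P : Subsemigroup C, IsNormalSubsemigroup P → (1 : C) ∉ P →
    ∀ (n : ℕ), 1 ≤ n → ∀ (c : Fin n → C) (g : Fin n → G),
      (∀ i, c i ∈ P) → (∀ i, g i ∉ C) → conjProd (fun i => (c i : G)) g ∉ C

/-- The amalgam `A *_C B` of two groups along homomorphisms `φ : C → A` and `ψ : C → B`:
the quotient of the free product `A * B` by the normal closure of all `φ(c) ψ(c)⁻¹`. -/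
abbrev Amalgam {A B C : Type*} [Group A] [Group B] [Group C] (φ : C →* A) (ψ : C →* B) : Type _ :=
  Monoid.Coprod A B ⧸ Subgroup.normalClosure
    (Set.range fun c : C =>
      (Monoid.Coprod.inl (φ c) * (Monoid.Coprod.inr (ψ c))⁻¹ : Monoid.Coprod A B))

/-- The canonical map `A → A *_C B`. -/
def Amalgam.inl {A B C : Type*} [Group A] [Group B] [Group C] (φ : C →* A) (ψ : C →* B) :
    A →* Amalgam φ ψ :=
  (QuotientGroup.mk' _).comp Monoid.Coprod.inl

/-! The amalgam acts on its Bass–Serre tree; let `o` be the vertex stabilised by `A`. The number of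
`B`-letters of `x` is half the distance from `o` to `x • o`, so `A` consists of the elements of
length 0. As `P` is normal and misses `C`, each of its elements fixes `o` and no adjacent edge.
Hence every conjugate `c^g` is a rotation about the single vertex `g⁻¹ • o`, which differs from `o`
when `g ∉ A`. It remains to see that a product of such rotations moves `o` (`length_prod_pos`).

If the centres are in good position (`IsStraight`), a local-to-global argument shows that nothing
cancels (`length_add_le_of_isChain`). Otherwise two neighbours share a centre and merge, which uses
that `P` is a semigroup, or they can be exchanged, one being conjugated by the other, so that the
product becomes simpler in a well-founded order.

Only a length function with the four-point condition is used, not the tree itself. It is read off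
normal forms (`isTreeLength_length`), with `length_conj` giving the rotation property. -/

/-! ### Tree length functions. -/

/-- An integral length function on a group `G` coming from an action on a tree: the left invariant
pseudo-distance `L (x⁻¹ * y)` satisfies the four-point condition. -/
structure IsTreeLength {G : Type*} [Group G] (L : G → ℕ) : Prop where
  one : L 1 = 0
  inv : ∀ x, L x⁻¹ = L x
  four_point_one : ∀ x y z,
    L x + L (y⁻¹ * z) ≤ max (L y + L (x⁻¹ * z)) (L z + L (x⁻¹ * y))

namespace IsTreeLength

variable {G : Type*} [Group G] {L : G → ℕ}

theorem symm (hL : IsTreeLength L) (x y : G) : L (x⁻¹ * y) = L (y⁻¹ * x) := by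
  rw [← hL.inv]; congr 1; group

theorem self (hL : IsTreeLength L) (x : G) : L (x⁻¹ * x) = 0 := by
  simp [hL.one]

theorem smul (L : G → ℕ) (g x y : G) : L ((g * x)⁻¹ * (g * y)) = L (x⁻¹ * y) := by
  congr 1; group

theorem four_point (hL : IsTreeLength L) (a x y z : G) :
    L (a⁻¹ * x) + L (y⁻¹ * z) ≤
      max (L (a⁻¹ * y) + L (x⁻¹ * z)) (L (a⁻¹ * z) + L (x⁻¹ * y)) := by
  have h := hL.four_point_one (a⁻¹ * x) (a⁻¹ * y) (a⁻¹ * z)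
  rwa [smul L, smul L, smul L] at h

theorem triangle (hL : IsTreeLength L) (x y z : G) :
    L (x⁻¹ * z) ≤ L (x⁻¹ * y) + L (y⁻¹ * z) := by
  have h := hL.four_point x z y y
  have h1 := hL.self y
  have h2 := hL.symm z y
  omega

theorem mul_le (hL : IsTreeLength L) (x y : G) : L (x * y) ≤ L x + L y := by
  have h := hL.triangle x⁻¹ 1 y
  simpa using h

theorem mul_left (hL : IsTreeLength L) {z : G} (hz : L z = 0) (x : G) : L (z * x) = L x := by
  have h1 := hL.mul_le z x
  have h2 := hL.mul_le z⁻¹ (z * x)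
  rw [inv_mul_cancel_left, hL.inv] at h2
  omega

theorem mul_right (hL : IsTreeLength L) {z : G} (hz : L z = 0) (x : G) : L (x * z) = L x := by
  rw [← hL.inv, mul_inv_rev, hL.mul_left (by rw [hL.inv, hz]), hL.inv]

end IsTreeLength

/-! ### Rotations and straight products. -/

/-- A set `Q` of elements fixing the base point of a tree, each of which is a rotation having no
other fixed point. -/
structure IsRotationSet {G : Type*} [Group G] (L : G → ℕ) (Q : Set G) : Prop where
  mul_mem : ∀ p ∈ Q, ∀ q ∈ Q, p * q ∈ Q
  conj_mem : ∀ q ∈ Q, ∀ z, L z = 0 → z⁻¹ * q * z ∈ Q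
  length_conj : ∀ q ∈ Q, ∀ g, L (g⁻¹ * q * g) = 2 * L g

section Rotations

variable {G : Type*} [Group G] {L : G → ℕ} {Q : Set G}

/-- The pair `p = (u, x)` consists of a rotation `x` and its centre `u`. -/
def IsRotation (Q : Set G) (p : G × G) : Prop := p.1⁻¹ * p.2 * p.1 ∈ Q

theorem IsRotation.conj {p : G × G} (hp : IsRotation Q p) (g : G) :
    IsRotation Q (g * p.1, g * p.2 * g⁻¹) := by
  unfold IsRotation at *
  convert hp using 1
  group

theorem IsRotation.conj' {p : G × G} (hp : IsRotation Q p) (g : G) :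
    IsRotation Q (g⁻¹ * p.1, g⁻¹ * p.2 * g) := by
  simpa using hp.conj g⁻¹

theorem IsRotation.dist_apply (hQ : IsRotationSet L Q) {u x : G} (h : IsRotation Q (u, x))
    (a : G) : L (a⁻¹ * (x * a)) = 2 * L (u⁻¹ * a) := by
  rw [← hQ.length_conj _ h]
  congr 1
  group

theorem IsRotation.dist_center (hL : IsTreeLength L) (hQ : IsRotationSet L Q) {u x : G}
    (h : IsRotation Q (u, x)) (a : G) : L (u⁻¹ * (x * a)) = L (u⁻¹ * a) := by
  have h1 := h.dist_apply hQ u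
  rw [hL.self] at h1
  have h2 : u⁻¹ * (x * a) = (u⁻¹ * (x * u)) * (u⁻¹ * a) := by group
  rw [h2, hL.mul_left (by simpa using h1)]

theorem IsRotation.length_eq_zero (hL : IsTreeLength L) (hQ : IsRotationSet L Q) {u x : G}
    (h : IsRotation Q (u, x)) (hu : L u = 0) : L x = 0 := by
  have h1 := h.dist_apply hQ 1
  have h2 := hL.inv u
  simp only [inv_one, one_mul, mul_one] at h1
  omega

theorem IsRotation.mul (hL : IsTreeLength L) (hQ : IsRotationSet L Q) {u x v y : G}
    (h : IsRotation Q (u, x)) (h' : IsRotation Q (v, y)) (huv : L (u⁻¹ * v) = 0) :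
    IsRotation Q (u, x * y) := by
  have h1 := hQ.mul_mem _ h _ (hQ.conj_mem _ h' (v⁻¹ * u) (by rw [hL.symm, huv]))
  unfold IsRotation
  convert h1 using 1
  simp only
  group

/-- Local condition on two consecutive rotations in a product under which nothing cancels. -/
def IsStraight (L : G → ℕ) (p q : G × G) : Prop :=
  0 < L (p.1⁻¹ * q.1) ∧ L q.1 < L p.1 + L (p.1⁻¹ * q.1) ∧
    (L p.1 = L q.1 + L (p.1⁻¹ * q.1) → L p.1 ≤ L (q.2⁻¹ * p.1))

/-- The centre `v` is the midpoint between `o` and `y • o`. If `v` is not between `o` and `u`, then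
`u` lies on the side of `o` at `v`, opposite to `y • o`. -/
theorem IsStraight.length_add_le (hL : IsTreeLength L) (hQ : IsRotationSet L Q) {u x v y : G}
    (hv : IsRotation Q (v, y)) (h : IsStraight L (u, x) (v, y)) :
    L (u⁻¹ * v) + L (v⁻¹ * y) ≤ L (u⁻¹ * y) := by
  obtain ⟨h1, -, h3⟩ := h
  simp only at h1 h3
  have e1 := hv.dist_apply hQ 1
  have e2 := hv.dist_center hL hQ 1
  have e3 := hL.four_point v 1 u y
  have e4 := hL.triangle 1 v u
  have e5 := hL.symm u v
  have e6 := hL.symm u y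
  have e7 := hL.inv v
  have e8 := hL.four_point v u 1 y
  have e9 := hL.inv u
  simp only [inv_one, one_mul, mul_one] at e1 e2 e3 e4 e8
  -- When `v` is between `o` and `u`, the last clause of `IsStraight` excludes backtracking at `v`.
  by_cases h : L u = L v + L (u⁻¹ * v)
  · have := h3 h
    omega
  · omega

/-- Inductively, the rest `X` of the product sends `o` beyond the next centre `v`, seen from `u`. At
`u` the points `X • o`, `v` and `o` thus lie in one direction. Applying `x` puts `x * X • o` in the
direction of `x • o`, away from `t`. -/
theorem length_add_le_of_isChain (hL : IsTreeLength L) (hQ : IsRotationSet L Q)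
    (l : List (G × G)) : ∀ u x : G, (∀ p ∈ (u, x) :: l, IsRotation Q p ∧ 0 < L p.1) →
      ((u, x) :: l).IsChain (IsStraight L) → ∀ t : G, L (t⁻¹ * u) + L (u⁻¹ * x) ≤ L (t⁻¹ * x) →
      0 < L (t⁻¹ * u) →
      L (t⁻¹ * u) + L (u⁻¹ * (((u, x) :: l).map Prod.snd).prod) ≤
        L (t⁻¹ * (((u, x) :: l).map Prod.snd).prod) := by
  induction l with
  | nil => intro u x _ _ t ht _; simpa using ht
  | cons q l ih =>
    obtain ⟨v, y⟩ := q
    intro u x hl hc t ht htu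
    rw [List.isChain_cons_cons] at hc
    have hu := hl (u, x) (by simp)
    have hv := hl (v, y) (by simp)
    have hs := hc.1
    have h1 := ih v y (fun p hp => hl p (List.mem_cons_of_mem _ hp)) hc.2 u
      (hs.length_add_le hL hQ hv.1) hs.1
    rw [List.map_cons, List.prod_cons]
    set X := (((v, y) :: l).map Prod.snd).prod
    have h2 := hs.1
    have h3 := hs.2.1
    simp only at h2 h3 hu hv ⊢
    -- directions at `u`: `X` and `v`, `v` and `1`
    have e1 := hL.four_point u v 1 X
    have e2 := hL.symm v u
    have e3 := hu.1.dist_center hL hQ 1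
    have e4 := hu.1.dist_center hL hQ X
    have e5 := hL.symm t u
    have e6 := hL.symm t x
    have e7 := hL.symm (x * X) t
    have e8 := hL.four_point u (x * X) t x
    have e9 : L (x⁻¹ * (x * X)) = L X := by rw [inv_mul_cancel_left]
    have e10 := hL.inv v
    have e11 := hL.inv u
    have e12 := hL.symm (x * X) x
    simp only [inv_one, one_mul, mul_one] at *
    omega

end Rotations

/-! ### The complexity order. -/

/-- The sum of the entries of a list, the `i`-th entry counted `i` times. -/
def weightedSum : List ℕ → ℕ
  | [] => 0
  | a :: l => a + l.sum + weightedSum l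

theorem weightedSum_append (l l' : List ℕ) :
    weightedSum (l ++ l') = weightedSum l + l.length * l'.sum + weightedSum l' := by
  induction l with
  | nil => simp [weightedSum]
  | cons a l ih =>
    simp only [List.cons_append, weightedSum, ih, List.sum_append, List.length_cons]
    ring

section Complexity

variable {G : Type*} {L : G → ℕ}

/-- The distances from the base point to the centres of a list of rotations. -/
def centerLengths (L : G → ℕ) (l : List (G × G)) : List ℕ := l.map fun p => L p.1

/-- The complexity order on lists of rotations: compare the number of rotations, then the total
distance of their centres from the base point, then the weighted total distance. -/
def Simpler (L : G → ℕ) (l' l : List (G × G)) : Prop :=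
  l'.length < l.length ∨ l'.length = l.length ∧
    ((centerLengths L l').sum < (centerLengths L l).sum ∨
      (centerLengths L l').sum = (centerLengths L l).sum ∧
        weightedSum (centerLengths L l') < weightedSum (centerLengths L l))

theorem wellFounded_simpler (L : G → ℕ) : WellFounded (Simpler L) := by
  have h := InvImage.wf (r := Prod.Lex (· < ·) (Prod.Lex (· < ·) (· < ·)))
    (fun l : List (G × G) => (l.length, (centerLengths L l).sum, weightedSum (centerLengths L l)))
    (WellFounded.prod_lex Nat.lt_wfRel.wf (WellFounded.prod_lex Nat.lt_wfRel.wf Nat.lt_wfRel.wf))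
  refine Subrelation.wf ?_ h
  intro l' l hl
  unfold Simpler at hl
  simpa only [InvImage, Prod.lex_def] using hl

/-- With the total fixed, later entries weigh more, so moving distance from the second entry to the
first lowers the weighted sum. -/
theorem simpler_of_pair {l₁ l₂ : List (G × G)} {p q p' q' : G × G}
    (h : L p'.1 + L q'.1 < L p.1 + L q.1 ∨
      L p'.1 + L q'.1 = L p.1 + L q.1 ∧ L q'.1 < L q.1) :
    Simpler L (l₁ ++ p' :: q' :: l₂) (l₁ ++ p :: q :: l₂) := by
  right
  refine ⟨by simp, ?_⟩
  simp only [centerLengths, List.map_append, List.map_cons, List.sum_append, List.sum_cons,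
    weightedSum_append, weightedSum]
  rcases h with h | ⟨h, h'⟩
  · left; omega
  · right
    refine ⟨by omega, ?_⟩
    have e : L p'.1 + (L q'.1 + (List.map (fun p => L p.1) l₂).sum) =
      L p.1 + (L q.1 + (List.map (fun p => L p.1) l₂).sum) := by omega
    rw [e]
    omega

end Complexity

/-! ### Products of rotations move the base point. -/

section Rotations

variable {G : Type*} [Group G] {L : G → ℕ} {Q : Set G}

theorem IsTreeLength.conj (hL : IsTreeLength L) {z : G} (hz : L z = 0) (x : G) :
    L (z⁻¹ * x * z) = L x := by
  rw [hL.mul_right hz, hL.mul_left (by rw [hL.inv, hz])]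

theorem prod_map_conj (z : G) (l : List (G × G)) :
    ((l.map fun p => (z⁻¹ * p.1, z⁻¹ * p.2 * z)).map Prod.snd).prod =
      z⁻¹ * (l.map Prod.snd).prod * z := by
  induction l with
  | nil => simp
  | cons p l ih =>
    rw [List.map_cons, List.map_cons, List.prod_cons, ih, List.map_cons, List.prod_cons]
    group

/-- A nonempty product of rotations whose centres differ from the base point moves the
base point. -/
theorem length_prod_pos (hL : IsTreeLength L) (hQ : IsRotationSet L Q) (l : List (G × G)) :
    (∀ p ∈ l, IsRotation Q p) → (∃ p ∈ l, 0 < L p.1) → 0 < L (l.map Prod.snd).prod := by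
  induction l using (wellFounded_simpler L).induction with
  | _ l ih =>
  intro hl hpos
  -- The exchanges below may carry a centre onto `o`. Such a rotation `z` fixes `o` and is pulled to
  -- the front, conjugating what it passes; there it does not affect the length and is dropped.
  by_cases h0 : ∃ p ∈ l, L p.1 = 0
  · obtain ⟨⟨u, z⟩, hp, hu⟩ := h0
    obtain ⟨l₁, l₂, rfl⟩ := List.append_of_mem hp
    have hz := (hl _ hp).length_eq_zero hL hQ hu
    have h := ih ((l₁.map fun p => (z⁻¹ * p.1, z⁻¹ * p.2 * z)) ++ l₂) (Or.inl (by simp))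
      (by
        intro p hp
        rcases List.mem_append.1 hp with hp | hp
        · obtain ⟨q, hq, rfl⟩ := List.mem_map.1 hp
          exact (hl q (by simp [hq])).conj' z
        · exact hl p (by simp [hp]))
      (by
        obtain ⟨p, hp, hp0⟩ := hpos
        simp only [List.mem_append, List.mem_cons] at hp
        rcases hp with hp | rfl | hp
        · refine ⟨_, List.mem_append_left _ (List.mem_map_of_mem hp), ?_⟩
          rwa [hL.mul_left (by rw [hL.inv, hz])]
        · exact absurd hu hp0.ne'
        · exact ⟨p, List.mem_append_right _ hp, hp0⟩)
    rw [List.map_append, List.prod_append, prod_map_conj] at h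
    rw [← hL.mul_left (z := z⁻¹) (by rw [hL.inv, hz])]
    convert h using 2
    simp only [List.map_append, List.map_cons, List.prod_append, List.prod_cons]
    group
  push Not at h0
  by_cases hc : l.IsChain (IsStraight L)
  · obtain ⟨p, hp, -⟩ := hpos
    match l, hp with
    | (u, x) :: l, _ =>
      have hu := hl (u, x) (by simp)
      have hu0 := Nat.pos_of_ne_zero (h0 (u, x) (by simp))
      have h1 := hu.dist_apply hQ 1
      have h2 := hu.dist_center hL hQ 1
      have h3 := hL.inv u
      simp only [inv_one, one_mul, mul_one] at h1 h2
      have h := length_add_le_of_isChain hL hQ l u x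
        (fun p hp => ⟨hl p hp, Nat.pos_of_ne_zero (h0 p hp)⟩) hc 1
        (by simp only [inv_one, one_mul]; omega) (by simpa using hu0)
      simp only [inv_one, one_mul] at h hu0
      omega
  obtain ⟨l₁, l₂, p, q, rfl, hs⟩ : ∃ l₁ l₂ p q, l = l₁ ++ p :: q :: l₂ ∧ ¬ IsStraight L p q := by
    obtain ⟨i, hi, hs⟩ := List.exists_not_getElem_of_not_isChain hc
    exact ⟨l.take i, l.drop (i + 2), l[i], l[i + 1], by simp, hs⟩
  clear hc
  obtain ⟨u, x⟩ := p
  obtain ⟨v, y⟩ := q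
  have hu := hl (u, x) (by simp)
  have hv := hl (v, y) (by simp)
  have hu0 := Nat.pos_of_ne_zero (h0 (u, x) (by simp))
  have hv0 := Nat.pos_of_ne_zero (h0 (v, y) (by simp))
  simp only at hu0 hv0
  have hl₁ : ∀ p ∈ l₁, IsRotation Q p := fun p hp => hl p (by simp [hp])
  have hl₂ : ∀ p ∈ l₂, IsRotation Q p := fun p hp => hl p (by simp [hp])
  by_cases huv : L (u⁻¹ * v) = 0
  · have h := ih (l₁ ++ (u, x * y) :: l₂) (Or.inl (by simp))
      (by
        simp only [List.mem_append, List.mem_cons]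
        rintro p (hp | rfl | hp)
        · exact hl₁ p hp
        · exact hu.mul hL hQ hv huv
        · exact hl₂ p hp)
      ⟨(u, x * y), by simp, hu0⟩
    simpa [mul_assoc] using h
  -- If `u` is between `o` and `v`, write `x * y = (x * y * x⁻¹) * x`. The total does not grow, and
  -- the nearer centre `u` comes second.
  by_cases hfar : L v = L u + L (u⁻¹ * v)
  · have hxv : L (x * v) ≤ L v := by
      have e1 := hL.triangle 1 u (x * v)
      have e2 := hu.dist_center hL hQ v
      simp only [inv_one, one_mul] at e1
      omega
    have h := ih (l₁ ++ (x * v, x * y * x⁻¹) :: (u, x) :: l₂)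
      (simpler_of_pair (by simp only; omega))
      (by
        simp only [List.mem_append, List.mem_cons]
        rintro p (hp | rfl | rfl | hp)
        · exact hl₁ p hp
        · exact hv.conj x
        · exact hu
        · exact hl₂ p hp)
      ⟨(u, x), by simp, hu0⟩
    simpa [mul_assoc] using h
  -- Only the last clause of `IsStraight` can now fail. Writing `x * y = y * (y⁻¹ * x * y)` replaces
  -- `u` by the strictly nearer centre `y⁻¹ * u`.
  · have ⟨h1, h2⟩ : L u = L v + L (u⁻¹ * v) ∧ L (y⁻¹ * u) < L u := by
      by_contra hcon
      refine hs ⟨Nat.pos_of_ne_zero huv, ?_, fun h => ?_⟩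
      · have := hL.triangle 1 u v
        simp only [inv_one, one_mul] at this ⊢
        omega
      · simp only at h ⊢
        omega
    have h := ih (l₁ ++ (v, y) :: (y⁻¹ * u, y⁻¹ * x * y) :: l₂)
      (simpler_of_pair (by simp only; omega))
      (by
        simp only [List.mem_append, List.mem_cons]
        rintro p (hp | rfl | rfl | hp)
        · exact hl₁ p hp
        · exact hv
        · exact hu.conj' y
        · exact hl₂ p hp)
      ⟨(v, y), by simp, hv0⟩
    simpa [mul_assoc] using h

end Rotations

/-! ### Common prefixes as an ultrametric. -/

section CommonPrefix

variable {α : Type*} (s : Set α)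

open Classical in
/-- Twice the number of letters in `s` in the common prefix of two lists, plus one if both lists
continue after it with a letter in `s`. -/
noncomputable def commonPrefixCount : List α → List α → ℕ
  | x :: u, y :: v =>
    if x = y then (if x ∈ s then 2 else 0) + commonPrefixCount u v
    else if x ∈ s ∧ y ∈ s then 1 else 0
  | [], _ => 0
  | _ :: _, [] => 0

/-- The count will equal `L x + L y - L (x⁻¹ * y)`, twice a Gromov product; for it the four-point
condition is this ultrametric inequality. -/
theorem min_commonPrefixCount_le (u : List α) : ∀ v w,
    min (commonPrefixCount s u v) (commonPrefixCount s v w) ≤ commonPrefixCount s u w := by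
  induction u with
  | nil => intro v w; simp [commonPrefixCount]
  | cons x u ih =>
    intro v w
    match v, w with
    | [], _ => simp [commonPrefixCount]
    | y :: v, [] => simp [commonPrefixCount]
    | y :: v, z :: w =>
      have := ih v w
      simp only [commonPrefixCount]
      by_cases h1 : x = y
      · subst h1
        by_cases h2 : x = z
        · subst h2
          simp only [if_true]
          omega
        · simp [h2]
      · by_cases h2 : x = z
        · subst h2
          simp only [h1, if_false, if_true]
          by_cases hx : x ∈ s
          · simp only [hx, true_and, if_true]
            split_ifs <;> omega
          · simp [hx]
        · by_cases h3 : y = z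
          · subst h3
            simp [h1]
          · simp only [h1, h2, h3, if_false]
            by_cases hx : x ∈ s <;> by_cases hy : y ∈ s <;> by_cases hz : z ∈ s <;>
              simp [hx, hy, hz]

end CommonPrefix

/-! ### Reduced and normal words in amalgamated products. -/

namespace Monoid.PushoutI

variable {ι : Type*} {G : ι → Type*} {H : Type*} [∀ i, Group (G i)] [Group H]

/-- The product of a list of letters in the amalgamated product. -/
def listProd (φ : ∀ i, H →* G i) (l : List (Σ i, G i)) : PushoutI φ :=
  (l.map fun g => of g.1 g.2).prod

/-- The inverse of a letter. -/
def letterInv (g : Σ i, G i) : Σ i, G i := ⟨g.1, g.2⁻¹⟩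

/-- No letter lies in the base group and adjacent letters lie in different factors. -/
structure IsReducedList (φ : ∀ i, H →* G i) (l : List (Σ i, G i)) : Prop where
  chain : (l.map Sigma.fst).IsChain (· ≠ ·)
  notMem : ∀ g ∈ l, g.2 ∉ (φ g.1).range

/-- The number of letters in a list which are not in the factor `i₀`. -/
def letterCount [DecidableEq ι] (i₀ : ι) (l : List (Σ i, G i)) : ℕ :=
  (l.map Sigma.fst).countP (· ≠ i₀)

variable {φ : ∀ i, H →* G i}

@[simp] theorem listProd_nil : listProd φ [] = 1 := rfl

@[simp] theorem listProd_cons (g : Σ i, G i) (l : List (Σ i, G i)) :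
    listProd φ (g :: l) = of g.1 g.2 * listProd φ l := by simp [listProd]

@[simp] theorem listProd_append (l l' : List (Σ i, G i)) :
    listProd φ (l ++ l') = listProd φ l * listProd φ l' := by simp [listProd]

theorem listProd_reverse_inv (l : List (Σ i, G i)) :
    listProd φ (l.map letterInv).reverse = (listProd φ l)⁻¹ := by
  induction l with
  | nil => simp
  | cons g l ih => simp [ih, letterInv]

theorem listProd_map_inv (l : List (Σ i, G i)) :
    listProd φ (l.map letterInv) = (listProd φ l.reverse)⁻¹ := by
  rw [← listProd_reverse_inv, List.map_reverse, List.reverse_reverse]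

theorem map_fst_map_letterInv (l : List (Σ i, G i)) :
    (l.map letterInv).map Sigma.fst = l.map Sigma.fst := by
  rw [List.map_map]; rfl

theorem IsReducedList.inv {l : List (Σ i, G i)} (h : IsReducedList φ l) :
    IsReducedList φ (l.map letterInv) where
  chain := by rw [map_fst_map_letterInv]; exact h.chain
  notMem := by
    intro g hg
    obtain ⟨g, hg', rfl⟩ := List.mem_map.1 hg
    exact fun h' => h.notMem g hg' (inv_mem_iff.1 h')

theorem IsReducedList.reverse {l : List (Σ i, G i)} (h : IsReducedList φ l) :
    IsReducedList φ l.reverse where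
  chain := by
    rw [List.map_reverse, List.isChain_reverse]
    exact h.chain.imp fun _ _ => Ne.symm
  notMem g hg := h.notMem g (List.mem_reverse.1 hg)

theorem IsReducedList.tail {g : Σ i, G i} {l : List (Σ i, G i)} (h : IsReducedList φ (g :: l)) :
    IsReducedList φ l where
  chain := by have := h.chain; rw [List.map_cons] at this; exact this.tail
  notMem g hg := h.notMem g (List.mem_cons_of_mem _ hg)

theorem IsReducedList.append_cons {i : ι} {a b g : G i} {l l' : List (Σ i, G i)}
    (h : IsReducedList φ (⟨i, a⟩ :: l)) (h' : IsReducedList φ (⟨i, b⟩ :: l'))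
    (hg : g ∉ (φ i).range) : IsReducedList φ (l.reverse ++ ⟨i, g⟩ :: l') where
  chain := by
    have h1 := h.reverse.chain
    have h2 := h'.chain
    simp only [List.map_append, List.map_cons, List.reverse_cons, List.map_nil] at *
    simpa using h1.append_overlap (l₂ := [i]) h2 (by simp)
  notMem x hx := by
    simp only [List.mem_append, List.mem_cons, List.mem_reverse] at hx
    rcases hx with hx | rfl | hx
    · exact h.notMem x (List.mem_cons_of_mem _ hx)
    · exact hg
    · exact h'.notMem x (List.mem_cons_of_mem _ hx)

theorem IsReducedList.cons {g : Σ i, G i} {l : List (Σ i, G i)} (h : IsReducedList φ l)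
    (hg : g.2 ∉ (φ g.1).range) (hl : ∀ i ∈ (l.map Sigma.fst).head?, g.1 ≠ i) :
    IsReducedList φ (g :: l) where
  chain := by rw [List.map_cons, List.isChain_cons]; exact ⟨hl, h.chain⟩
  notMem x hx := by
    rcases List.mem_cons.1 hx with rfl | hx
    · exact hg
    · exact h.notMem x hx

theorem isReducedList_nil : IsReducedList φ [] := ⟨by simp, by simp⟩

/-- Elements of the base group can be moved from the right of a reduced list to its left. -/
theorem IsReducedList.exists_mul_base {l : List (Σ i, G i)} (h : IsReducedList φ l) (c : H) :
    ∃ c' l', IsReducedList φ l' ∧ l'.map Sigma.fst = l.map Sigma.fst ∧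
      listProd φ l * base φ c = base φ c' * listProd φ l' := by
  rcases List.eq_nil_or_concat l with rfl | ⟨l, ⟨i, g⟩, rfl⟩
  · exact ⟨c, [], h, rfl, by simp⟩
  · refine ⟨1, l ++ [⟨i, g * φ i c⟩], ⟨?_, ?_⟩, by simp, ?_⟩
    · simpa using h.chain
    · intro x hx
      rcases List.mem_append.1 hx with hx | hx
      · exact h.notMem x (by simp [hx])
      · rw [List.mem_singleton] at hx
        subst hx
        have := h.notMem ⟨i, g⟩ (by simp)
        rwa [Subgroup.mul_mem_cancel_right _ (MonoidHom.mem_range.2 ⟨c, rfl⟩)]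
    · simp [mul_assoc, of_apply_eq_base]

theorem NormalWord.Transversal.eq_of_mul_inv_mem (d : NormalWord.Transversal φ) {i : ι} {a b : G i}
    (ha : a ∈ d.set i) (hb : b ∈ d.set i) (hab : a * b⁻¹ ∈ (φ i).range) : a = b := by
  have := (d.compl i).1 (a₁ := (1, ⟨a, ha⟩)) (a₂ := (⟨_, hab⟩, ⟨b, hb⟩)) (by simp)
  simpa using congrArg (fun p => (p.2 : G i)) this

/-- Lists of letters from a transversal, read from the right. -/
def IsNormalList (d : NormalWord.Transversal φ) (l : List (Σ i, G i)) : Prop :=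
  IsReducedList φ l ∧ ∀ g ∈ l, g.2 ∈ d.set g.1

theorem exists_isNormalList (d : NormalWord.Transversal φ) (x : PushoutI φ) :
    ∃ c l, IsNormalList d l ∧ x = base φ c * listProd φ l.reverse := by
  classical
  set w : NormalWord d := NormalWord.equiv x
  have hx : x = w.prod := (NormalWord.equiv.symm_apply_apply x).symm
  have hw : ∀ g ∈ w.toList, g.2 ∈ d.set g.1 := fun g hg => w.normalized g.1 g.2 hg
  refine ⟨w.head, w.toList.reverse, ⟨IsReducedList.reverse ⟨?_, ?_⟩, ?_⟩, ?_⟩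
  · rw [List.isChain_map]; exact w.chain_ne
  · intro g hg hr
    exact w.ne_one g hg (d.eq_of_mul_inv_mem (hw g hg) (d.one_mem g.1) (by simpa using hr))
  · simpa using hw
  · rw [hx, NormalWord.prod, List.reverse_reverse]
    simp [listProd, CoprodI.Word.prod, map_list_prod, List.map_map, Function.comp_def]

section Length

variable [DecidableEq ι] (i₀ : ι)

open Classical in
/-- The number of letters of the normal form of an element which are not in the factor `i₀`. -/
noncomputable def length (d : NormalWord.Transversal φ) (x : PushoutI φ) : ℕ :=
  letterCount i₀ (NormalWord.equiv (d := d) x).toList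

variable {i₀}

/-- Passing from a reduced word to the normal form keeps the sequence of factors, so any reduced
word computes the length. -/
theorem length_base_mul_listProd (d : NormalWord.Transversal φ) (c : H) {l : List (Σ i, G i)}
    (hl : IsReducedList φ l) : length i₀ d (base φ c * listProd φ l) = letterCount i₀ l := by
  classical
  let w : CoprodI.Word G := ⟨l, fun g hg h1 => hl.notMem g hg (h1 ▸ one_mem _), by
    have := hl.chain; rwa [List.isChain_map] at this⟩
  have hw : Reduced φ w := hl.notMem
  obtain ⟨w', hw', hfst⟩ := hw.exists_normalWord_prod_eq d
  have hp : (c • w').prod = base φ c * listProd φ l := by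
    rw [NormalWord.prod_base_smul, hw']
    simp [w, listProd, CoprodI.Word.prod, map_list_prod, List.map_map, Function.comp_def]
  rw [← hp, length, show (c • w').prod = NormalWord.equiv.symm (c • w') from rfl]
  have h : (NormalWord.equiv (d := d) (NormalWord.equiv.symm (c • w'))).toList = w'.toList := by
    rw [Equiv.apply_symm_apply]; rfl
  rw [h, letterCount, hfst, letterCount]

end Length

end Monoid.PushoutI

/-! ### Word length as a tree length; factor elements as rotations. -/

namespace Monoid.PushoutI

section LetterCount

variable {ι : Type*} {G : ι → Type*} [DecidableEq ι] {i₀ : ι}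

theorem letterCount_cons (g : Σ i, G i) (l : List (Σ i, G i)) :
    letterCount i₀ (g :: l) = letterCount i₀ l + if g.1 ≠ i₀ then 1 else 0 := by
  simp [letterCount, List.countP_cons]

theorem letterCount_append (l l' : List (Σ i, G i)) :
    letterCount i₀ (l ++ l') = letterCount i₀ l + letterCount i₀ l' := by
  simp [letterCount]

theorem letterCount_reverse (l : List (Σ i, G i)) :
    letterCount i₀ l.reverse = letterCount i₀ l := by
  simp [letterCount, List.map_reverse]

end LetterCount

variable {ι : Type*} {G : ι → Type*} {H : Type*} [∀ i, Group (G i)] [Group H]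
variable {φ : ∀ i, H →* G i}

section Length

variable [DecidableEq ι] {i₀ : ι}

theorem letterCount_map_inv (l : List (Σ i, G i)) :
    letterCount i₀ (l.map letterInv) = letterCount i₀ l := by
  rw [letterCount, map_fst_map_letterInv, letterCount]

/-- The number of letters of a product `x * y⁻¹`, in terms of the common suffix of the normal forms
of `x` and `y`. -/
theorem exists_isReducedList_mul_inv (d : NormalWord.Transversal φ)
    (hι : ∀ i j, i ≠ i₀ → j ≠ i₀ → i = j) (t : List (Σ i, G i)) :
    ∀ s : List (Σ i, G i), IsNormalList d t → IsNormalList d s →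
      ∃ l, IsReducedList φ l ∧ listProd φ t.reverse * (listProd φ s.reverse)⁻¹ = listProd φ l ∧
        letterCount i₀ l + commonPrefixCount {g | g.1 ≠ i₀} t s =
          letterCount i₀ t + letterCount i₀ s := by
  induction t with
  | nil =>
    intro s _ hs
    refine ⟨s.map letterInv, hs.1.inv, ?_, ?_⟩
    · rw [listProd_map_inv]; simp
    · rw [letterCount_map_inv]; simp [commonPrefixCount, letterCount]
  | cons x t ih =>
    rintro (_ | ⟨y, s⟩) ht hs
    · refine ⟨(x :: t).reverse, ht.1.reverse, by simp, ?_⟩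
      rw [letterCount_reverse]; simp [commonPrefixCount, letterCount]
    obtain ⟨i, a⟩ := x
    obtain ⟨j, b⟩ := y
    have ha := ht.2 ⟨i, a⟩ (by simp)
    have hb := hs.2 ⟨j, b⟩ (by simp)
    have ha' := ht.1.notMem ⟨i, a⟩ (by simp)
    by_cases hij : i = j
    · subst hij
      by_cases hab : a = b
      · subst hab
        obtain ⟨l, hl, hp, hc⟩ := ih s ⟨ht.1.tail, fun g hg => ht.2 g (List.mem_cons_of_mem _ hg)⟩
          ⟨hs.1.tail, fun g hg => hs.2 g (List.mem_cons_of_mem _ hg)⟩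
        refine ⟨l, hl, ?_, ?_⟩
        · rw [← hp]; simp [mul_assoc]
        · simp only [commonPrefixCount, letterCount_cons, Set.mem_ofPred_eq, if_true]
          split_ifs <;> omega
      -- Distinct representatives `a`, `b` merge into one letter outside the base group. If `i ≠ i₀`
      -- this saves one counted letter, the extra 1 in `commonPrefixCount`.
      · refine ⟨t.reverse ++ ⟨i, a * b⁻¹⟩ :: s.map letterInv,
          ht.1.append_cons (b := b⁻¹) hs.1.inv fun h => hab (d.eq_of_mul_inv_mem ha hb h), ?_, ?_⟩
        · simp [listProd_map_inv, mul_assoc]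
        · have : (⟨i, a⟩ : Σ i, G i) ≠ ⟨i, b⟩ := by simpa using hab
          simp only [commonPrefixCount, letterCount_cons, letterCount_append, letterCount_reverse,
            letterCount_map_inv, Set.mem_ofPred_eq, this, if_false]
          by_cases hi : i = i₀ <;> simp [hi]
          omega
    · have hred : IsReducedList φ (⟨i, a⟩ :: (⟨j, b⟩ :: s).map letterInv) :=
        hs.1.inv.cons ha' (by simpa [letterInv] using hij)
      refine ⟨t.reverse ++ ⟨i, a⟩ :: (⟨j, b⟩ :: s).map letterInv,
        ht.1.append_cons hred ha', ?_, ?_⟩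
      · rw [listProd_append, listProd_cons, listProd_map_inv]
        simp [mul_assoc]
      · have : (⟨i, a⟩ : Σ i, G i) ≠ ⟨j, b⟩ := fun h => hij (congrArg Sigma.fst h)
        have h' : ¬ (i ≠ i₀ ∧ j ≠ i₀) := fun h => hij (hι i j h.1 h.2)
        simp only [commonPrefixCount, letterCount_cons, letterCount_append, letterCount_reverse,
          letterCount_map_inv, Set.mem_ofPred_eq, this, if_false, h']
        omega

theorem length_mul_base (d : NormalWord.Transversal φ) (x : PushoutI φ) (c : H) :
    length i₀ d (x * base φ c) = length i₀ d x := by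
  obtain ⟨c₁, l, hl, rfl⟩ := exists_isNormalList d x
  obtain ⟨c₂, l', hl', hfst, hp⟩ := hl.1.reverse.exists_mul_base c
  rw [mul_assoc, hp, ← mul_assoc, ← map_mul, length_base_mul_listProd d _ hl',
    length_base_mul_listProd d _ hl.1.reverse, letterCount, hfst, letterCount]

theorem length_base_mul (d : NormalWord.Transversal φ) (x : PushoutI φ) (c : H) :
    length i₀ d (base φ c * x) = length i₀ d x := by
  obtain ⟨c₁, l, hl, rfl⟩ := exists_isNormalList d x
  rw [← mul_assoc, ← map_mul, length_base_mul_listProd d _ hl.1.reverse,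
    length_base_mul_listProd d _ hl.1.reverse]

theorem length_listProd (d : NormalWord.Transversal φ) {l : List (Σ i, G i)}
    (hl : IsReducedList φ l) : length i₀ d (listProd φ l) = letterCount i₀ l := by
  simpa using length_base_mul_listProd (i₀ := i₀) d 1 hl

theorem length_inv (d : NormalWord.Transversal φ) (x : PushoutI φ) :
    length i₀ d x⁻¹ = length i₀ d x := by
  obtain ⟨c, l, hl, rfl⟩ := exists_isNormalList d x
  rw [length_base_mul, mul_inv_rev, ← map_inv, length_mul_base, ← listProd_map_inv,
    length_listProd d hl.1.inv, length_listProd d hl.1.reverse, letterCount_map_inv,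
    letterCount_reverse]

/-- The number of letters outside one of the two factors of an amalgamated product is a
length function of an action on a tree. -/
theorem isTreeLength_length (d : NormalWord.Transversal φ)
    (hι : ∀ i j, i ≠ i₀ → j ≠ i₀ → i = j) : IsTreeLength (length i₀ d) where
  one := by simpa [letterCount] using length_listProd (i₀ := i₀) d (isReducedList_nil (φ := φ))
  inv := length_inv d
  four_point_one := by
    -- Inverses are used because cancellation in `x⁻¹ * y = x⁻¹ * (y⁻¹)⁻¹` happens along a common
    -- suffix of the normal forms of `x⁻¹` and `y⁻¹`.
    choose c t ht hx using fun x : PushoutI φ => exists_isNormalList d x⁻¹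
    have key : ∀ x y, length i₀ d (x⁻¹ * y) + commonPrefixCount {g | g.1 ≠ i₀} (t x) (t y) =
        length i₀ d x + length i₀ d y := by
      intro x y
      obtain ⟨l, hl, hp, hc⟩ := exists_isReducedList_mul_inv d hι (t x) (t y) (ht x) (ht y)
      have e : x⁻¹ * y⁻¹⁻¹ = base φ (c x) * (listProd φ l * base φ (c y)⁻¹) := by
        rw [hx x, hx y, ← hp, map_inv]; group
      rw [inv_inv] at e
      rw [e, length_base_mul, length_mul_base, length_listProd d hl, hc, ← length_inv d x,
        ← length_inv d y, hx x, hx y, length_base_mul, length_base_mul,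
        length_listProd d (ht x).1.reverse, length_listProd d (ht y).1.reverse,
        letterCount_reverse, letterCount_reverse]
    intro x y z
    have h1 := key y x
    have h2 := key x z
    have h3 := key y z
    have h4 := min_commonPrefixCount_le {g : Σ i, G i | g.1 ≠ i₀} (t y) (t x) (t z)
    have h5 := length_inv (i₀ := i₀) d (y⁻¹ * x)
    rw [mul_inv_rev, inv_inv] at h5
    omega

theorem length_eq_zero_iff (d : NormalWord.Transversal φ) (x : PushoutI φ) :
    length i₀ d x = 0 ↔ x ∈ (of i₀ : G i₀ →* PushoutI φ).range := by
  constructor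
  · intro h
    obtain ⟨c, l, hl, rfl⟩ := exists_isNormalList d x
    rw [length_base_mul_listProd d _ hl.1.reverse, letterCount_reverse] at h
    have hb : base φ c ∈ (of i₀ : G i₀ →* PushoutI φ).range := ⟨φ i₀ c, of_apply_eq_base φ i₀ c⟩
    refine mul_mem hb ?_
    clear hb
    have h' : ∀ g ∈ l, g.1 = i₀ := by
      simpa [letterCount, List.countP_eq_zero] using h
    refine list_prod_mem fun y hy => ?_
    obtain ⟨⟨i, g⟩, hg, rfl⟩ := List.mem_map.1 hy
    obtain rfl : i = i₀ := h' _ (List.mem_reverse.1 hg)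
    exact ⟨g, rfl⟩
  · rintro ⟨a, rfl⟩
    by_cases ha : a ∈ (φ i₀).range
    · obtain ⟨c, rfl⟩ := ha
      simpa [letterCount, of_apply_eq_base] using
        length_base_mul_listProd (i₀ := i₀) d c (isReducedList_nil (φ := φ))
    · have h : IsReducedList φ [⟨i₀, a⟩] := isReducedList_nil.cons ha (by simp)
      simpa [letterCount] using length_listProd (i₀ := i₀) d h

/-- The letter `b` is a dummy ensuring that `l` does not start in the factor `i₀`; then `l⁻¹ p l` is
itself reduced. -/
theorem length_conj_of_isReducedList (d : NormalWord.Transversal φ) {p : G i₀} {b : G i₀}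
    (hp : p ∉ (φ i₀).range) {l : List (Σ i, G i)} (hl : IsReducedList φ (⟨i₀, b⟩ :: l)) :
    length i₀ d ((listProd φ l)⁻¹ * of i₀ p * listProd φ l) = 2 * letterCount i₀ l := by
  have h := hl.inv.append_cons hl hp
  have e := length_listProd (i₀ := i₀) d h
  rw [listProd_append, listProd_reverse_inv, letterCount_append, letterCount_reverse,
    letterCount_map_inv, letterCount_cons, listProd_cons, ← mul_assoc] at e
  rw [e]
  simp
  omega

theorem length_conj (d : NormalWord.Transversal φ) {p : G i₀}
    (hp : ∀ a : G i₀, a⁻¹ * p * a ∉ (φ i₀).range) (x : PushoutI φ) :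
    length i₀ d (x⁻¹ * of i₀ p * x) = 2 * length i₀ d x := by
  obtain ⟨c, l, hl, rfl⟩ := exists_isNormalList d x
  replace hl := hl.1.reverse
  generalize l.reverse = l at hl
  rw [length_base_mul_listProd d _ hl]
  have e : (base φ c * listProd φ l)⁻¹ * of i₀ p * (base φ c * listProd φ l) =
      (listProd φ l)⁻¹ * of i₀ ((φ i₀ c)⁻¹ * p * φ i₀ c) * listProd φ l := by
    simp only [map_mul, map_inv, of_apply_eq_base]; group
  rw [e]
  by_cases h : i₀ ∈ (l.map Sigma.fst).head?
  · match l, h with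
    | ⟨i, a⟩ :: l, h =>
      obtain rfl : i = i₀ := by simpa using h
      -- The base part and a leading letter of the factor `i₀` are absorbed by conjugating `p`.
      have := length_conj_of_isReducedList d (hp (φ i c * a)) hl
      rw [letterCount_cons]
      simp only [ne_eq, not_true_eq_false, if_false, add_zero]
      rw [← this]
      congr 1
      simp only [listProd_cons, map_mul, map_inv]
      group
  · refine length_conj_of_isReducedList (b := p) d (hp _) (hl.cons (by simpa using hp 1) ?_)
    rintro i hi rfl
    exact h hi

/-- A normal subsemigroup of a factor avoiding the amalgamated subgroup consists of rotations. -/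
theorem isRotationSet_map (d : NormalWord.Transversal φ) {P : Subsemigroup (G i₀)}
    (hP : IsNormalSubsemigroup P) (hPφ : (P : Set (G i₀)) ∩ ((φ i₀).range : Set (G i₀)) = ∅) :
    IsRotationSet (length i₀ d) ((of i₀ : G i₀ →* PushoutI φ) '' P) where
  mul_mem := by
    rintro _ ⟨p, hp, rfl⟩ _ ⟨q, hq, rfl⟩
    exact ⟨p * q, P.mul_mem hp hq, map_mul _ _ _⟩
  conj_mem := by
    rintro _ ⟨p, hp, rfl⟩ z hz
    obtain ⟨a, rfl⟩ := (length_eq_zero_iff d z).1 hz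
    exact ⟨_, hP p hp a, by simp⟩
  length_conj := by
    rintro _ ⟨p, hp, rfl⟩ g
    exact length_conj d (fun a ha => (Set.eq_empty_iff_forall_notMem.1 hPφ) _ ⟨hP p hp a, ha⟩) g

end Length

end Monoid.PushoutI

/-! ### The result for `PushoutI`. -/

namespace Monoid.PushoutI

theorem conjProd_notMem_range {ι : Type*} {G : ι → Type*} {H : Type*} [∀ i, Group (G i)]
    [Group H] {φ : ∀ i, H →* G i} (hφ : ∀ i, Function.Injective (φ i)) {i₀ : ι}
    (hι : ∀ i j, i ≠ i₀ → j ≠ i₀ → i = j) {P : Subsemigroup (G i₀)}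
    (hP : IsNormalSubsemigroup P) (hPφ : (P : Set (G i₀)) ∩ ((φ i₀).range : Set (G i₀)) = ∅)
    {n : ℕ} (hn : 1 ≤ n) {p : Fin n → G i₀} {f : Fin n → PushoutI φ} (hp : ∀ i, p i ∈ P)
    (hf : ∀ i, f i ∉ (of i₀ : G i₀ →* PushoutI φ).range) :
    conjProd (fun i => of i₀ (p i)) f ∉ (of i₀ : G i₀ →* PushoutI φ).range := by
  classical
  obtain ⟨d⟩ := NormalWord.transversal_nonempty φ hφ
  have h := length_prod_pos (isTreeLength_length d hι) (isRotationSet_map d hP hPφ)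
    (List.ofFn fun i => ((f i)⁻¹, (f i)⁻¹ * of i₀ (p i) * f i))
    (by
      intro q hq
      obtain ⟨i, rfl⟩ := List.mem_ofFn.1 hq
      exact ⟨p i, hp i, by group⟩)
    (by
      refine ⟨_, List.mem_ofFn.2 ⟨⟨0, hn⟩, rfl⟩, Nat.pos_of_ne_zero fun h => hf ⟨0, hn⟩ ?_⟩
      rwa [length_inv, length_eq_zero_iff] at h)
  rw [List.map_ofFn] at h
  rw [← length_eq_zero_iff d]
  exact h.ne'

end Monoid.PushoutI

universe u v w

theorem map_conjProd {G G' : Type*} [Group G] [Group G'] (θ : G →* G') {n : ℕ}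
    (c g : Fin n → G) : θ (conjProd c g) = conjProd (fun i => θ (c i)) (fun i => θ (g i)) := by
  simp [conjProd, map_list_prod, List.map_ofFn, Function.comp_def]

/-! ### Transfer to the quotient description of the amalgam. -/

namespace Amalgam

open Monoid

variable {A : Type u} {B : Type v} {C : Type w} [Group A] [Group B] [Group C]

/-- Two groups as a family of groups in a common universe. -/
def Factor (A : Type u) (B : Type v) : Bool → Type (max u v)
  | true => ULift.{v} A
  | false => ULift.{u} B

instance : ∀ b, Group (Factor A B b)
  | true => inferInstanceAs (Group (ULift.{v} A))
  | false => inferInstanceAs (Group (ULift.{u} B))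

/-- The first factor as a member of the family. -/
def factorTrue (A : Type u) (B : Type v) [Group A] [Group B] : Factor A B true ≃* A :=
  (MulEquiv.ulift : ULift.{v} A ≃* A)

/-- The second factor as a member of the family. -/
def factorFalse (A : Type u) (B : Type v) [Group A] [Group B] : Factor A B false ≃* B :=
  (MulEquiv.ulift : ULift.{u} B ≃* B)

/-- The inclusions of the amalgamated subgroup into the family of factors. -/
def factorMap (φ : C →* A) (ψ : C →* B) : ∀ b, C →* Factor A B b
  | true => (factorTrue A B).symm.toMonoidHom.comp φ
  | false => (factorFalse A B).symm.toMonoidHom.comp ψ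

theorem factorMap_injective {φ : C →* A} {ψ : C →* B} (hφ : Function.Injective φ)
    (hψ : Function.Injective ψ) : ∀ b, Function.Injective (factorMap φ ψ b)
  | true => (factorTrue A B).symm.injective.comp hφ
  | false => (factorFalse A B).symm.injective.comp hψ

variable (φ : C →* A) (ψ : C →* B)

/-- The canonical map `B → A *_C B`. -/
def inr : B →* Amalgam φ ψ :=
  (QuotientGroup.mk' _).comp Coprod.inr

theorem inl_apply_eq_inr_apply (c : C) : inl φ ψ (φ c) = inr φ ψ (ψ c) := by
  have h : (Coprod.inl (φ c) * (Coprod.inr (ψ c))⁻¹ : Coprod A B) ∈ Subgroup.normalClosure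
      (Set.range fun c : C => (Coprod.inl (φ c) * (Coprod.inr (ψ c))⁻¹ : Coprod A B)) :=
    Subgroup.subset_normalClosure ⟨c, rfl⟩
  rw [← QuotientGroup.eq_one_iff] at h
  rw [← mul_inv_eq_one]
  exact h

/-- The comparison map from the amalgam to the pushout of the family of its factors. -/
def toPushoutI : Amalgam φ ψ →* PushoutI (factorMap φ ψ) :=
  QuotientGroup.lift _
    (Coprod.lift ((PushoutI.of true).comp (factorTrue A B).symm.toMonoidHom)
      ((PushoutI.of false).comp (factorFalse A B).symm.toMonoidHom)) <| by
    have h : Subgroup.normalClosure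
        (Set.range fun c : C => (Coprod.inl (φ c) * (Coprod.inr (ψ c))⁻¹ : Coprod A B)) ≤
        (Coprod.lift ((PushoutI.of (φ := factorMap φ ψ) true).comp
          (factorTrue A B).symm.toMonoidHom)
          ((PushoutI.of false).comp (factorFalse A B).symm.toMonoidHom)).ker := by
      refine Subgroup.normalClosure_le_normal ?_
      rintro _ ⟨c, rfl⟩
      have h1 := PushoutI.of_apply_eq_base (factorMap φ ψ) true c
      have h2 := PushoutI.of_apply_eq_base (factorMap φ ψ) false c
      rw [← h2] at h1
      simp only [SetLike.mem_coe, MonoidHom.mem_ker, map_mul, map_inv, Coprod.lift_apply_inl,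
        Coprod.lift_apply_inr, mul_inv_eq_one]
      exact h1
    exact h

/-- The maps from the members of the family of factors to the amalgam. -/
def ofFactor : ∀ b, Factor A B b →* Amalgam φ ψ
  | true => (inl φ ψ).comp (factorTrue A B).toMonoidHom
  | false => (inr φ ψ).comp (factorFalse A B).toMonoidHom

/-- The comparison map from the pushout of the family of factors to the amalgam. -/
def ofPushoutI : PushoutI (factorMap φ ψ) →* Amalgam φ ψ :=
  PushoutI.lift (ofFactor φ ψ) ((inl φ ψ).comp φ) <| by
    rintro (_ | _)
    · ext c
      exact (inl_apply_eq_inr_apply φ ψ c).symm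
    · rfl

theorem toPushoutI_inl (a : A) :
    toPushoutI φ ψ (inl φ ψ a) = PushoutI.of true ((factorTrue A B).symm a) := by
  simp [toPushoutI, inl]

theorem ofPushoutI_of_true (a : Factor A B true) :
    ofPushoutI φ ψ (PushoutI.of true a) = inl φ ψ (factorTrue A B a) := by
  simp [ofPushoutI, ofFactor]

theorem ofPushoutI_toPushoutI (x : Amalgam φ ψ) : ofPushoutI φ ψ (toPushoutI φ ψ x) = x := by
  suffices (ofPushoutI φ ψ).comp (toPushoutI φ ψ) = MonoidHom.id _ from DFunLike.congr_fun this x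
  ext a
  · simp [toPushoutI, ofPushoutI, ofFactor, inl]
  · simp [toPushoutI, ofPushoutI, ofFactor, inr]

theorem toPushoutI_mem_range_iff (x : Amalgam φ ψ) :
    toPushoutI φ ψ x ∈ (PushoutI.of (φ := factorMap φ ψ) true).range ↔ x ∈ (inl φ ψ).range := by
  constructor
  · rintro ⟨a, ha⟩
    refine ⟨factorTrue A B a, ?_⟩
    rw [← ofPushoutI_toPushoutI φ ψ x, ← ha, ofPushoutI_of_true]
  · rintro ⟨a, rfl⟩
    exact ⟨_, (toPushoutI_inl φ ψ a).symm⟩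

variable {φ ψ}

theorem conjProd_notMem_range_inl (hφ : Function.Injective φ) (hψ : Function.Injective ψ)
    {P : Subsemigroup A} (hP : IsNormalSubsemigroup P)
    (hPφ : (P : Set A) ∩ (φ.range : Set A) = ∅) {n : ℕ} (hn : 1 ≤ n) {d : Fin n → A}
    {f : Fin n → Amalgam φ ψ} (hd : ∀ i, d i ∈ P) (hf : ∀ i, f i ∉ (inl φ ψ).range) :
    conjProd (fun i => inl φ ψ (d i)) f ∉ (inl φ ψ).range := by
  rw [← toPushoutI_mem_range_iff, map_conjProd]
  simp only [toPushoutI_inl]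
  refine PushoutI.conjProd_notMem_range (factorMap_injective hφ hψ) (by decide)
    (P := P.comap (factorTrue A B : Factor A B true →ₙ* A)) ?_ ?_ hn ?_ ?_
  · intro p hp a
    simpa using hP _ hp (factorTrue A B a)
  · rw [Set.eq_empty_iff_forall_notMem] at hPφ ⊢
    rintro p ⟨hp, c, rfl⟩
    exact hPφ (φ c) ⟨hp, c, rfl⟩
  · intro i
    simpa using hd i
  · intro i
    rw [toPushoutI_mem_range_iff]
    exact hf i

end Amalgam

/-- The free product is the amalgam over the trivial group: the normal closure divided out is
trivial, and avoiding the amalgamated subgroup means avoiding 1. -/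
theorem isMultiMalnormal_range_inl {A : Type u} {B : Type v} [Group A] [Group B] :
    IsMultiMalnormal (Monoid.Coprod.inl : A →* Monoid.Coprod A B).range := by
  intro P hP h1 n hn c g hc hg
  let φ : Unit →* A := 1
  let ψ : Unit →* B := 1
  let π : Monoid.Coprod A B →* Amalgam φ ψ := QuotientGroup.mk' _
  have hker : ∀ x, π x = 1 → x = 1 := by
    intro x hx
    have h : Subgroup.normalClosure (Set.range fun c : Unit =>
        (Monoid.Coprod.inl (φ c) * (Monoid.Coprod.inr (ψ c))⁻¹ : Monoid.Coprod A B)) ≤ ⊥ := by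
      refine Subgroup.normalClosure_le_normal ?_
      rintro _ ⟨c, rfl⟩
      simp [φ, ψ]
    exact Subgroup.mem_bot.1 (h ((QuotientGroup.eq_one_iff x).1 hx))
  have hπ : Function.Injective π := (injective_iff_map_eq_one π).2 hker
  choose d hd using fun i => (c i).2
  let ρ : A →* (Monoid.Coprod.inl : A →* Monoid.Coprod A B).range :=
    (Monoid.Coprod.inl : A →* Monoid.Coprod A B).rangeRestrict
  have hρ : ∀ i, ρ (d i) = c i := fun i => Subtype.ext (hd i)
  have hP' : IsNormalSubsemigroup (P.comap (ρ : A →ₙ* _)) := by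
    intro p hp a
    simpa using hP (ρ p) hp (ρ a)
  have key := Amalgam.conjProd_notMem_range_inl (φ := φ) (ψ := ψ)
    (Function.injective_of_subsingleton φ) (Function.injective_of_subsingleton ψ) hP'
    (by
      rw [Set.eq_empty_iff_forall_notMem]
      rintro _ ⟨hp, c, rfl⟩
      exact h1 (by simpa [φ] using hp))
    hn (d := d) (f := fun i => π (g i))
    (fun i => by
      rw [Subsemigroup.mem_comap]
      exact (hρ i).symm ▸ hc i)
    (fun i ⟨a, ha⟩ => hg i ⟨a, hπ ha⟩)
  rintro ⟨a, ha⟩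
  refine key ⟨a, ?_⟩
  change π _ = _
  rw [ha, map_conjProd]
  simp only [← hd]
  rfl

theorem corollaryC {A : Type*} {B : Type*} [Group A] [Group B] :
    IsMultiMalnormal (Monoid.Coprod.inl : A →* Monoid.Coprod A B).range ∧
    ∀ {C : Type*} [Group C] (φ : C →* A) (ψ : C →* B),
      Function.Injective φ → Function.Injective ψ →
      ∀ P : Subsemigroup A, IsNormalSubsemigroup P →
        (P : Set A) ∩ (φ.range : Set A) = ∅ →
        ∀ (n : ℕ), 1 ≤ n → ∀ (d : Fin n → A) (f : Fin n → Amalgam φ ψ),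
          (∀ i, d i ∈ P) → (∀ i, f i ∉ (Amalgam.inl φ ψ).range) →
          conjProd (fun i => Amalgam.inl φ ψ (d i)) f ∉ (Amalgam.inl φ ψ).range :=
  ⟨isMultiMalnormal_range_inl, fun _ _ hφ hψ _ hP hPφ _ hn _ _ hd hf =>
    Amalgam.conjProd_notMem_range_inl hφ hψ hP hPφ hn hd hf⟩
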